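/- Let $K\in\{\mathbb R,\mathbb C,\mathbb H\}$, $d=\dim_{\mathbb R}K$, and let $G(n)$ be respectively $PO(n,1)$, $PU(n,1)$ or $PSp(n,1)$, acting on the $K$-hyperbolic space $\mathbb H^n_K$ (with its standard metric, of curvature $-1$ if $K=\mathbb R$ and in $[-4,-1]$ otherwise) and on its boundary $\partial_\infty\mathbb H^n_K$. Assume $d(n-1)\ge 2$ and $m\ge n$. Let $\Gamma\le G(n)$ be a torsion-free uniform lattice with critical exponent $\delta_\Gamma$, and let $\{\nu_a\}_{a\in\mathbb H^n_K}$ be its Patterson–Sullivan density, i.e. a measurable $\Gamma$-equivariant family of probability measures on $\partial_\infty\mathbb H^n_K$ with $\nu_a\ll\nu_b$ and $\frac{d\nu_a}{d\nu_b}(\xi)=e^{-\delta_\Gamma\beta_b(a,\xi)}$ for all $a,b$, where $\beta_b$ is the Busemann function pointed at $b$. Let $(X,\mu_X)$ be a standard Borel probability space without atoms on which $\Gamma$ acts by measure preserving transformations. A measurable cocycle is a measurable map $\sigma:\Gamma\times X\to G(m)$ with $\sigma(\gamma_1\gamma_2,x)=\sigma(\gamma_1,\gamma_2x)\sigma(\gamma_2,x)$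 for all $\gamma_1,\gamma_2\in\Gamma$ and almost every $x$. A boundary map of $\sigma$ is a measurable map $\phi:\partial_\infty\mathbb H^n_K\times X\to\partial_\infty\mathbb H^m_K$ with $\phi(\gamma\xi,\gamma x)=\sigma(\gamma,x)\phi(\xi,x)$ for all $\gamma\in\Gamma$ and almost all $(\xi,x)$ (null sets of the boundary being those of the measures $\nu_a$). The cocycle $\sigma$ admits a natural map if it has an essentially unique boundary map $\phi$, almost every slice $\phi_x=\phi(\cdot,x)$ of $\phi$ is essentially injective, and there is a measurable map $F:\mathbb H^n_K\times X\to\mathbb H^m_K$ such that, for almost every $x$ and every $a$, $F(a,x)$ is the barycenter of $(\phi_x)_*\nu_a$, that is, the unique minimum point of $y\mapsto\int\beta_o(y,\phi_x(\xi))\,d\nu_a(\xi)$; $F$ is then called the natural map of $\sigma$. The natural volume of $\sigma$ is $$NV(\sigma)=\int_{\Gamma\backslash\mathbb H^n_K}\int_X\sqrt{\det F_x^*g_m}\;d\mu_X(x),$$ where $F_x=F(\cdot,x)$ and $g_m$ is the Riemannian metric of $\mathbb H^m_K$. Let $\sigma:\Gamma\times X\to G(m)$ be a measurable cocycle that admits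 a natural map. For every measurable map $f:X\to G(m)$, the twisted map $\sigma^f(\gamma,x)=f(\gamma x)^{-1}\sigma(\gamma,x)f(x)$ is again a measurable cocycle that admits a natural map, and $$NV(\sigma^f)=NV(\sigma).$$ Hence every measurable cocycle $\sigma'$ cohomologous to $\sigma$ (that is, for some measurable $f:X\to G(m)$ and every $\gamma\in\Gamma$, $\sigma'(\gamma,x)=\sigma^f(\gamma,x)$ for almost every $x$) admits a natural map and satisfies $NV(\sigma')=NV(\sigma)$. -/

import Mathlib

open MeasureTheory Filter Topology
open scoped ENNReal Matrix Quaternion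

set_option linter.unusedSectionVars false

noncomputable section

/-- The scalars of the hyperbolic spaces: `K` is one of `ℝ`, `ℂ`, `ℍ`, with its usual
conjugation and absolute value. -/
class HypScalars (K : Type*) [NormedDivisionRing K] [NormedAlgebra ℝ K] [StarRing K] :
    Prop where
  cstar : CStarRing K
  iso : Nonempty (K ≃⋆ₐ[ℝ] ℝ) ∨ Nonempty (K ≃⋆ₐ[ℝ] ℂ) ∨ Nonempty (K ≃⋆ₐ[ℝ] ℍ[ℝ])

instance : HypScalars ℝ := ⟨inferInstance, Or.inl ⟨StarAlgEquiv.refl _ _⟩⟩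
instance : HypScalars ℂ := ⟨inferInstance, Or.inr (Or.inl ⟨StarAlgEquiv.refl _ _⟩)⟩
instance : HypScalars ℍ[ℝ] := ⟨inferInstance, Or.inr (Or.inr ⟨StarAlgEquiv.refl _ _⟩)⟩

namespace NaturalVolume

section Scalars

variable (K : Type*) [NormedDivisionRing K] [NormedAlgebra ℝ K] [StarRing K] [HypScalars K]

instance finiteDimensional_scalars : FiniteDimensional ℝ K := by
  rcases HypScalars.iso (K := K) with ⟨⟨e⟩⟩ | ⟨⟨e⟩⟩ | ⟨⟨e⟩⟩
  · exact Module.Finite.equiv (e.toAlgEquiv.toLinearEquiv).symm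
  · exact Module.Finite.equiv (e.toAlgEquiv.toLinearEquiv).symm
  · exact Module.Finite.equiv (e.toAlgEquiv.toLinearEquiv).symm

variable {K}

theorem star_mul_self_eq (q : K) : star q * q = algebraMap ℝ K (‖q‖ ^ 2) := by
  have : CStarRing K := HypScalars.cstar
  have key : ∃ r : ℝ, 0 ≤ r ∧ star q * q = algebraMap ℝ K r := by
    rcases HypScalars.iso (K := K) with ⟨⟨e⟩⟩ | ⟨⟨e⟩⟩ | ⟨⟨e⟩⟩
    · refine ⟨(e q) ^ 2, sq_nonneg _, (EquivLike.injective e) ?_⟩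
      rw [map_mul, map_star]
      have := e.toAlgEquiv.commutes ((e q) ^ 2)
      change e _ = _ at this
      rw [this]
      simp [pow_two]
    · refine ⟨Complex.normSq (e q), Complex.normSq_nonneg _, (EquivLike.injective e) ?_⟩
      rw [map_mul, map_star]
      have := e.toAlgEquiv.commutes (Complex.normSq (e q))
      change e _ = _ at this
      rw [this]
      simp [Complex.normSq_eq_conj_mul_self]
    · refine ⟨Quaternion.normSq (e q), Quaternion.normSq_nonneg, (EquivLike.injective e) ?_⟩
      rw [map_mul, map_star]
      have := e.toAlgEquiv.commutes (Quaternion.normSq (e q))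
      change e _ = _ at this
      rw [this, Quaternion.star_mul_self]
      rfl
  obtain ⟨r, hr, h⟩ := key
  have h2 : ‖q‖ ^ 2 = r := by
    rw [pow_two, ← CStarRing.norm_star_mul_self, h, norm_algebraMap', Real.norm_of_nonneg hr]
  rw [h, h2]

end Scalars

section Group

variable (K : Type*) [NormedDivisionRing K] [NormedAlgebra ℝ K] [StarRing K]

/-- `Kⁿ` with its Euclidean norm. -/
abbrev Euc (n : ℕ) : Type _ := EuclideanSpace K (Fin n)

/-- Square matrices of size `n + 1`. -/
abbrev HMat (n : ℕ) : Type _ := Matrix (Fin n ⊕ Unit) (Fin n ⊕ Unit) K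

/-- The matrix `diag(1, …, 1, -1)`. -/
def formMatrix (n : ℕ) : HMat K n :=
  Matrix.diagonal (Sum.elim (fun _ => 1) (fun _ => -1))

/-- The unitary group of the form of signature `(n, 1)` over `K`, that is `O(n,1)`, `U(n,1)` or
`Sp(n,1)`. -/
def unitaryForm (n : ℕ) : Subgroup (HMat K n)ˣ where
  carrier := {g | g.1ᴴ * formMatrix K n * g.1 = formMatrix K n}
  one_mem' := by simp
  mul_mem' := by
    intro a b ha hb
    simp only [Set.mem_ofPred_eq] at ha hb ⊢
    rw [Units.val_mul, Matrix.conjTranspose_mul]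
    calc _ = b.1ᴴ * (a.1ᴴ * formMatrix K n * a.1) * b.1 := by simp only [Matrix.mul_assoc]
      _ = _ := by rw [ha, hb]
  inv_mem' := by
    intro a ha
    simp only [Set.mem_ofPred_eq] at ha ⊢
    have h1 : a.1 * a⁻¹.1 = 1 := a.mul_inv
    have h2 : a⁻¹.1ᴴ * a.1ᴴ = 1 := by
      rw [← Matrix.conjTranspose_mul, h1, Matrix.conjTranspose_one]
    calc _ = a⁻¹.1ᴴ * (a.1ᴴ * formMatrix K n * a.1) * a⁻¹.1 := by rw [ha]
      _ = (a⁻¹.1ᴴ * a.1ᴴ) * formMatrix K n * (a.1 * a⁻¹.1) := by simp only [Matrix.mul_assoc]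
      _ = _ := by rw [h1, h2, Matrix.one_mul, Matrix.mul_one]

theorem ne_zero_of_eq_diagonal {n : ℕ} {a : (HMat K n)ˣ} {l : K}
    (h : a.1 = Matrix.diagonal (fun _ => l)) : l ≠ 0 := by
  rintro rfl
  have h1 := a.mul_inv
  rw [h] at h1
  have h2 := congrFun (congrFun h1 (Sum.inr ())) (Sum.inr ())
  simp at h2

/-- The scalar matrices `l • 1` in `unitaryForm K n` with `l` in the centre of `K`. -/
def scalarSubgroup (n : ℕ) : Subgroup (unitaryForm K n) where
  carrier := {g | ∃ l : K, (∀ q : K, l * q = q * l) ∧ g.1.1 = Matrix.diagonal (fun _ => l)}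
  one_mem' := ⟨1, by simp, by simp⟩
  mul_mem' := by
    rintro a b ⟨l, hl, ha⟩ ⟨l', hl', hb⟩
    refine ⟨l * l', fun q => ?_, by simp [ha, hb]⟩
    rw [mul_assoc, hl', ← mul_assoc, hl, mul_assoc]
  inv_mem' := by
    rintro a ⟨l, hl, ha⟩
    have hl0 := ne_zero_of_eq_diagonal K ha
    refine ⟨l⁻¹, fun q => ?_, ?_⟩
    · rw [inv_mul_eq_iff_eq_mul₀ hl0, ← mul_assoc, hl, mul_assoc, mul_inv_cancel₀ hl0, mul_one]
    · have h3 : a.1.1 * Matrix.diagonal (fun _ => l⁻¹) = 1 := by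
        rw [ha, Matrix.diagonal_mul_diagonal]
        simp [hl0]
      simpa using Units.inv_eq_of_mul_eq_one_right h3

instance scalarSubgroup_normal (n : ℕ) : (scalarSubgroup K n).Normal where
  conj_mem := by
    rintro a ⟨l, hl, ha⟩ g
    refine ⟨l, hl, ?_⟩
    have hc : g.1.1 * Matrix.diagonal (fun _ => l) = Matrix.diagonal (fun _ => l) * g.1.1 := by
      ext i j
      rw [Matrix.mul_diagonal, Matrix.diagonal_mul]
      exact (hl _).symm
    have h1 : g.1.1 * g.1⁻¹.1 = 1 := g.1.mul_inv
    simp only [Subgroup.coe_mul, Subgroup.coe_inv, Units.val_mul, ha]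
    rw [hc, Matrix.mul_assoc, h1, Matrix.mul_one]

/-- The group `G(n)`, that is `PO(n,1)`, `PU(n,1)` or `PSp(n,1)`, with the quotient topology. -/
abbrev G (n : ℕ) : Type _ := unitaryForm K n ⧸ scalarSubgroup K n

instance measurableSpaceG (n : ℕ) : MeasurableSpace (G K n) := borel _
instance borelSpaceG (n : ℕ) : BorelSpace (G K n) := ⟨rfl⟩

end Group

section Action

variable {K : Type*} [NormedDivisionRing K] [NormedAlgebra ℝ K] [StarRing K] {n : ℕ}

/-- The vector `(z, 1)` of `K^{n+1}`. -/
def homog (z : Euc K n) : Fin n ⊕ Unit → K := Sum.elim (fun i => z i) (fun _ => 1)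

/-- The projective action in the affine chart: if `g (z, 1) = (w, t)`, the image of `z` is
`w t⁻¹`. -/
def fracLin (g : unitaryForm K n) (z : Euc K n) : Euc K n :=
  WithLp.toLp 2 fun i => (g.1.1 *ᵥ homog z) (Sum.inl i) * ((g.1.1 *ᵥ homog z) (Sum.inr ()))⁻¹

/-- The quadratic form `|v₁|² + ⋯ + |vₙ|² - |vₙ₊₁|²`. -/
def quadForm (v : Fin n ⊕ Unit → K) : ℝ := ∑ i, ‖v (Sum.inl i)‖ ^ 2 - ‖v (Sum.inr ())‖ ^ 2

theorem quadForm_homog (z : Euc K n) : quadForm (homog z) = ‖z‖ ^ 2 - 1 := by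
  simp [quadForm, homog, PiLp.norm_sq_eq_of_L2]

theorem quadForm_mul_right (v : Fin n ⊕ Unit → K) (l : K) :
    quadForm (fun i => v i * l) = quadForm v * ‖l‖ ^ 2 := by
  simp only [quadForm, norm_mul, mul_pow, sub_mul, Finset.sum_mul]

theorem mulVec_mul_right (A : HMat K n) (v : Fin n ⊕ Unit → K)
    (l : K) : A *ᵥ (fun i => v i * l) = fun i => (A *ᵥ v) i * l := by
  ext i
  simp only [Matrix.mulVec, dotProduct, Finset.sum_mul, mul_assoc]

variable [HypScalars K]

theorem algebraMap_quadForm (v : Fin n ⊕ Unit → K) :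
    algebraMap ℝ K (quadForm v) = star v ⬝ᵥ (formMatrix K n *ᵥ v) := by
  simp only [quadForm, formMatrix, map_sub, map_sum, dotProduct, Matrix.mulVec_diagonal,
    Fintype.sum_sum_type, ← star_mul_self_eq]
  simp [sub_eq_add_neg]

theorem quadForm_mulVec (g : unitaryForm K n) (v : Fin n ⊕ Unit → K) :
    quadForm (g.1.1 *ᵥ v) = quadForm v := by
  apply (algebraMap ℝ K).injective
  have hg : (g.1.1)ᴴ * formMatrix K n * g.1.1 = formMatrix K n := g.2
  rw [algebraMap_quadForm, algebraMap_quadForm, Matrix.star_mulVec, ← Matrix.dotProduct_mulVec,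
    Matrix.mulVec_mulVec, Matrix.mulVec_mulVec, hg]

theorem denom_ne_zero (g : unitaryForm K n) {z : Euc K n} (hz : ‖z‖ ≤ 1) :
    (g.1.1 *ᵥ homog z) (Sum.inr ()) ≠ 0 := by
  intro h0
  have h1 : quadForm (g.1.1 *ᵥ homog z) ≤ 0 := by
    rw [quadForm_mulVec, quadForm_homog]
    nlinarith [norm_nonneg z]
  have h2 : ∑ i, ‖(g.1.1 *ᵥ homog z) (Sum.inl i)‖ ^ 2 ≤ 0 := by
    simpa [quadForm, h0] using h1
  have h3 : g.1.1 *ᵥ homog z = 0 := by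
    ext j
    rcases j with i | ⟨⟩
    · have h4 := (Finset.single_le_sum (f := fun i => ‖(g.1.1 *ᵥ homog z) (Sum.inl i)‖ ^ 2)
        (fun i _ => sq_nonneg _) (Finset.mem_univ i)).trans h2
      have h5 := le_antisymm h4 (sq_nonneg _)
      simpa using h5
    · exact h0
  have h6 : homog z = 0 := by
    have h7 : g.1⁻¹.1 *ᵥ (g.1.1 *ᵥ homog z) = homog z := by
      rw [Matrix.mulVec_mulVec, Units.inv_mul, Matrix.one_mulVec]
    rw [← h7, h3, Matrix.mulVec_zero]
  have h8 := congrFun h6 (Sum.inr ())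
  simp [homog] at h8

theorem homog_fracLin (g : unitaryForm K n) {z : Euc K n} (hz : ‖z‖ ≤ 1) :
    homog (fracLin g z) =
      fun i => (g.1.1 *ᵥ homog z) i * ((g.1.1 *ᵥ homog z) (Sum.inr ()))⁻¹ := by
  ext i
  rcases i with i | ⟨⟩
  · simp [homog, fracLin]
  · simp only [mul_inv_cancel₀ (denom_ne_zero g hz)]
    simp [homog]

theorem norm_fracLin (g : unitaryForm K n) {z : Euc K n} (hz : ‖z‖ ≤ 1) :
    1 - ‖fracLin g z‖ ^ 2 =
      (1 - ‖z‖ ^ 2) * ‖((g.1.1 *ᵥ homog z) (Sum.inr ()))⁻¹‖ ^ 2 := by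
  have h := quadForm_homog (fracLin g z)
  rw [homog_fracLin g hz, quadForm_mul_right, quadForm_mulVec, quadForm_homog] at h
  linarith

theorem norm_fracLin_lt (g : unitaryForm K n) {z : Euc K n} (hz : ‖z‖ < 1) :
    ‖fracLin g z‖ < 1 := by
  have h := norm_fracLin g hz.le
  have h1 : 0 < 1 - ‖z‖ ^ 2 := by nlinarith [norm_nonneg z]
  have h2 : 0 < ‖((g.1.1 *ᵥ homog z) (Sum.inr ()))⁻¹‖ :=
    norm_pos_iff.2 (inv_ne_zero (denom_ne_zero g hz.le))
  have h3 : 0 < 1 - ‖fracLin g z‖ ^ 2 := by rw [h]; positivity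
  nlinarith [norm_nonneg (fracLin g z)]

theorem norm_fracLin_eq (g : unitaryForm K n) {z : Euc K n} (hz : ‖z‖ = 1) :
    ‖fracLin g z‖ = 1 := by
  have h := norm_fracLin g hz.le
  rw [hz] at h
  have h1 : ‖fracLin g z‖ ^ 2 = 1 := by linarith
  nlinarith [norm_nonneg (fracLin g z)]

theorem fracLin_one (z : Euc K n) : fracLin 1 z = z := by
  ext i
  simp [fracLin, homog]

theorem fracLin_mul (g h : unitaryForm K n) {z : Euc K n} (hz : ‖z‖ ≤ 1) :
    fracLin (g * h) z = fracLin g (fracLin h z) := by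
  have hd := denom_ne_zero h hz
  ext i
  simp only [fracLin]
  change _ = (g.1.1 *ᵥ homog (fracLin h z)) (Sum.inl i) *
    ((g.1.1 *ᵥ homog (fracLin h z)) (Sum.inr ()))⁻¹
  rw [homog_fracLin h hz, mulVec_mul_right]
  simp only [Matrix.mulVec_mulVec, Subgroup.coe_mul, Units.val_mul]
  rw [mul_inv_rev, inv_inv, mul_assoc, inv_mul_cancel_left₀ hd]

theorem fracLin_scalar {g : unitaryForm K n} (hg : g ∈ scalarSubgroup K n) (z : Euc K n) :
    fracLin g z = z := by
  obtain ⟨l, hl, h⟩ := hg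
  have hl0 := ne_zero_of_eq_diagonal K h
  ext i
  simp only [fracLin, h, Matrix.mulVec_diagonal]
  rw [hl]
  simp [homog, hl0]

end Action

section Spaces

variable (K : Type*) [NormedDivisionRing K] [NormedAlgebra ℝ K] [StarRing K] (n : ℕ)

/-- The `n`-dimensional hyperbolic space over `K`: the unit ball of `Kⁿ`, a point `z` standing for
the negative line spanned by `(z, 1)`. -/
def Hyp : Type _ := {z : Euc K n // ‖z‖ < 1}

/-- The boundary at infinity of `Hyp K n`: the unit sphere of `Kⁿ`. -/
def Bd : Type _ := {z : Euc K n // ‖z‖ = 1}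

instance : TopologicalSpace (Hyp K n) := instTopologicalSpaceSubtype
instance : TopologicalSpace (Bd K n) := instTopologicalSpaceSubtype
instance : MeasurableSpace (Hyp K n) := borel _
instance : MeasurableSpace (Bd K n) := borel _
instance : BorelSpace (Hyp K n) := ⟨rfl⟩
instance : BorelSpace (Bd K n) := ⟨rfl⟩

/-- The base point, the centre of the ball. -/
def basept : Hyp K n := ⟨0, by simp⟩

instance : Nonempty (Hyp K n) := ⟨basept K n⟩

variable [HypScalars K]

instance : MulAction (unitaryForm K n) (Hyp K n) where
  smul g z := ⟨fracLin g z.1, norm_fracLin_lt g z.2⟩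
  one_smul z := Subtype.ext (fracLin_one z.1)
  mul_smul g h z := Subtype.ext (fracLin_mul g h z.2.le)

instance : MulAction (unitaryForm K n) (Bd K n) where
  smul g z := ⟨fracLin g z.1, norm_fracLin_eq g z.2⟩
  one_smul z := Subtype.ext (fracLin_one z.1)
  mul_smul g h z := Subtype.ext (fracLin_mul g h z.2.le)

/-- `G(n)` acts on the hyperbolic space through the fractional linear action. -/
instance : MulAction (G K n) (Hyp K n) :=
  MulAction.compHom _ (QuotientGroup.lift (scalarSubgroup K n)
    (MulAction.toPermHom (unitaryForm K n) (Hyp K n))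
    (fun _ hg => Equiv.ext fun z => Subtype.ext (fracLin_scalar hg z.1)))

/-- `G(n)` acts on the boundary at infinity through the fractional linear action. -/
instance : MulAction (G K n) (Bd K n) :=
  MulAction.compHom _ (QuotientGroup.lift (scalarSubgroup K n)
    (MulAction.toPermHom (unitaryForm K n) (Bd K n))
    (fun _ hg => Equiv.ext fun z => Subtype.ext (fracLin_scalar hg z.1)))

theorem mk_smul_hyp (g : unitaryForm K n) (z : Hyp K n) :
    (((QuotientGroup.mk g : G K n) • z : Hyp K n)).1 = fracLin g z.1 := rfl

theorem mk_smul_bd (g : unitaryForm K n) (z : Bd K n) :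
    (((QuotientGroup.mk g : G K n) • z : Bd K n)).1 = fracLin g z.1 := rfl

end Spaces

section Geometry

variable {K : Type*} [NormedDivisionRing K] [NormedAlgebra ℝ K] [StarRing K] {n : ℕ}

/-- The positive definite Hermitian product of `Kⁿ`. -/
def herm (z w : Euc K n) : K := ∑ i, star (z i) * w i

/-- The hyperbolic distance, normalized so that the sectional curvature is `-1` over `ℝ` and lies
between `-4` and `-1` over `ℂ` and `ℍ`. -/
def hdist (a b : Hyp K n) : ℝ :=
  Real.arcosh (‖1 - herm a.1 b.1‖ / (√(1 - ‖a.1‖ ^ 2) * √(1 - ‖b.1‖ ^ 2)))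

/-- The quadratic form on the tangent space `Kⁿ` at `a` of the Riemannian metric whose distance is
`hdist`. -/
def metricQ (a : Hyp K n) (u : Euc K n) : ℝ :=
  ((1 - ‖a.1‖ ^ 2) * ‖u‖ ^ 2 + ‖herm a.1 u‖ ^ 2) / (1 - ‖a.1‖ ^ 2) ^ 2

/-- The Riemannian metric at `a`, the polarization of `metricQ a`. -/
def metric (a : Hyp K n) (u v : Euc K n) : ℝ :=
  (metricQ a (u + v) - metricQ a (u - v)) / 4

/-- `c`, restricted to `[0, ∞)`, is a unit speed geodesic ray from `b` to the boundary point `ξ`. -/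
structure IsGeodesicRay (c : ℝ → Hyp K n) (b : Hyp K n) (ξ : Bd K n) : Prop where
  start : c 0 = b
  isometric : ∀ s t : ℝ, 0 ≤ s → 0 ≤ t → hdist (c s) (c t) = |s - t|
  tendsto : Tendsto (fun t => (c t).1) atTop (𝓝 ξ.1)

/-- A geodesic ray from `b` to `ξ`. -/
def ray (b : Hyp K n) (ξ : Bd K n) : ℝ → Hyp K n :=
  Classical.epsilon fun c => IsGeodesicRay c b ξ

/-- The Busemann function `β_b(a, ξ)` pointed at `b`. -/
def busemann (b a : Hyp K n) (ξ : Bd K n) : ℝ :=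
  limUnder atTop fun t : ℝ => hdist a (ray b ξ t) - hdist b (ray b ξ t)

/-- The function `Λ_ν`, the average of the Busemann functions pointed at the base point. -/
def avgBusemann (ν : Measure (Bd K n)) (y : Hyp K n) : ℝ :=
  ∫ ξ, busemann (basept K n) y ξ ∂ν

/-- `y` is the barycenter of `ν`: the unique point where `Λ_ν` attains its minimum. -/
def IsBarycenter (ν : Measure (Bd K n)) (y : Hyp K n) : Prop :=
  ∀ z, z ≠ y → avgBusemann ν y < avgBusemann ν z

variable [HypScalars K]

/-- The critical exponent of `Γ`, through the Poincaré series at the base point. -/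
def criticalExponent (Γ : Subgroup (G K n)) : ℝ :=
  sInf {s : ℝ | 0 < s ∧
    Summable fun γ : Γ => Real.exp (-s * hdist (γ • basept K n) (basept K n))}

/-- `α`-conformal densities of `Γ`. -/
structure IsConformalDensity (Γ : Subgroup (G K n)) (α : ℝ)
    (ν : Hyp K n → Measure (Bd K n)) : Prop where
  measurable : Measurable ν
  isProb : ∀ a, IsProbabilityMeasure (ν a)
  equivariant : ∀ (γ : Γ) (a : Hyp K n), ν (γ • a) = (ν a).map (fun ξ => γ • ξ)
  absCont : ∀ a b, ν a ≪ ν b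
  rnDeriv_eq : ∀ a b, (ν a).rnDeriv (ν b) =ᵐ[ν b]
    fun ξ => ENNReal.ofReal (Real.exp (-α * busemann b a ξ))

/-- Patterson–Sullivan densities of `Γ`. -/
def IsPattersonSullivan (Γ : Subgroup (G K n)) (ν : Hyp K n → Measure (Bd K n)) : Prop :=
  0 < criticalExponent Γ ∧ IsConformalDensity Γ (criticalExponent Γ) ν

/-- Torsion-free uniform lattices of `G(n)`: torsion-free, discrete, cocompact subgroups. -/
structure IsTorsionFreeUniformLattice (Γ : Subgroup (G K n)) : Prop where
  discrete : DiscreteTopology Γ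
  cocompact : CompactSpace (G K n ⧸ Γ)
  torsionFree : ∀ γ ∈ Γ, IsOfFinOrder γ → γ = 1

end Geometry

section Cocycles

variable {K : Type*} [NormedDivisionRing K] [NormedAlgebra ℝ K] [StarRing K] [HypScalars K]
  {n m : ℕ} {Γ : Subgroup (G K n)} {X : Type*} [MeasurableSpace X] [MulAction Γ X]

/-- Measurable cocycles `σ : Γ × X → G(m)` for a countable discrete `Γ`. -/
structure IsCocycle (μ : Measure X) (σ : Γ → X → G K m) : Prop where
  measurable : ∀ γ, Measurable (σ γ)
  cocycle : ∀ γ₁ γ₂ : Γ, ∀ᵐ x ∂μ, σ (γ₁ * γ₂) x = σ γ₁ (γ₂ • x) * σ γ₂ x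

/-- The twisted cocycle `σ^f`. -/
def twist (σ : Γ → X → G K m) (f : X → G K m) : Γ → X → G K m :=
  fun γ x => (f (γ • x))⁻¹ * σ γ x * f x

/-- `σ₂` is cohomologous to `σ₁`; cocycles that agree almost everywhere are identified. -/
def Cohomologous (μ : Measure X) (σ₁ σ₂ : Γ → X → G K m) : Prop :=
  ∃ f : X → G K m, Measurable f ∧ ∀ γ, ∀ᵐ x ∂μ, σ₂ γ x = twist σ₁ f γ x

/-- Boundary maps of `σ`. The null sets of the boundary are those of the measure `ν₀`. -/
structure IsBoundaryMap (μ : Measure X) (ν₀ : Measure (Bd K n)) (σ : Γ → X → G K m)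
    (φ : Bd K n × X → Bd K m) : Prop where
  measurable : Measurable φ
  equivariant : ∀ γ : Γ, ∀ᵐ p ∂(ν₀.prod μ), φ (γ • p.1, γ • p.2) = σ γ p.2 • φ p

/-- `φ` is an essentially unique boundary map of `σ` with essentially injective slices. -/
structure IsEssUniqueInjectiveBoundaryMap (μ : Measure X) (ν₀ : Measure (Bd K n))
    (σ : Γ → X → G K m) (φ : Bd K n × X → Bd K m) : Prop
    extends IsBoundaryMap μ ν₀ σ φ where
  essUnique : ∀ ψ, IsBoundaryMap μ ν₀ σ ψ → ψ =ᵐ[ν₀.prod μ] φ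
  essInjective : ∀ᵐ x ∂μ, ∃ s ∈ ae ν₀, Set.InjOn (fun ξ => φ (ξ, x)) s

/-- `F` is the natural map of the cocycle `σ`: `F(a, x)` is the barycenter of the push-forward of
`ν_a` by the slice `φ_x` of the essentially unique boundary map `φ` of `σ`, whose slices are
essentially injective. Here `ν` is the Patterson–Sullivan density of `Γ`; all its members have the
same null sets, and these are the null sets of the boundary. -/
structure IsNaturalMap (μ : Measure X) (ν : Hyp K n → Measure (Bd K n)) (σ : Γ → X → G K m)
    (F : Hyp K n × X → Hyp K m) : Prop where
  measurable : Measurable F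
  barycenter : ∃ φ : Bd K n × X → Bd K m,
    IsEssUniqueInjectiveBoundaryMap μ (ν (basept K n)) σ φ ∧
    ∀ᵐ x ∂μ, ∀ a, IsBarycenter ((ν a).map fun ξ => φ (ξ, x)) (F (a, x))

/-- `σ` admits a natural map. -/
def AdmitsNaturalMap (μ : Measure X) (ν : Hyp K n → Measure (Bd K n)) (σ : Γ → X → G K m) :
    Prop :=
  ∃ F, IsNaturalMap μ ν σ F

end Cocycles

section Volume

variable (K : Type*) [NormedDivisionRing K] [NormedAlgebra ℝ K] [StarRing K] [HypScalars K]
  (n : ℕ)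

/-- A real basis of `Kⁿ`, giving global coordinates of the hyperbolic space. -/
def coordBasis : Module.Basis (Fin (Module.finrank ℝ (Euc K n))) ℝ (Euc K n) :=
  Module.finBasis ℝ (Euc K n)

/-- Lebesgue measure on the ball in the coordinates of `coordBasis`. -/
def lebesgue : Measure (Hyp K n) :=
  letI : MeasurableSpace (Euc K n) := borel _
  haveI : BorelSpace (Euc K n) := ⟨rfl⟩
  (coordBasis K n).addHaar.comap (fun z : Hyp K n => z.1)

variable {K n} {m : ℕ}

/-- The derivative at `a` of a map between hyperbolic spaces. -/
def hderiv (Ψ : Hyp K n → Hyp K m) (a : Hyp K n) : Euc K n →L[ℝ] Euc K m :=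
  fderiv ℝ (Function.extend (fun z : Hyp K n => z.1) (fun z => (Ψ z).1) 0) a.1

/-- The value `ω(u₁, …, u_p)` at `a` of the volume form `ω = √(det Ψ^* g_m)` on the coordinate
basis `u₁, …, u_p` of the tangent space. -/
def pullbackVolume (Ψ : Hyp K n → Hyp K m) (a : Hyp K n) : ℝ :=
  √(Matrix.det (Matrix.of fun i j : Fin (Module.finrank ℝ (Euc K n)) =>
    metric (Ψ a) (hderiv Ψ a (coordBasis K n i)) (hderiv Ψ a (coordBasis K n j))))

/-- A fundamental domain for the action of `Γ` on the hyperbolic space. -/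
def fundDomain (Γ : Subgroup (G K n)) : Set (Hyp K n) :=
  Classical.epsilon fun D => IsFundamentalDomain Γ D (lebesgue K n)

variable {X : Type*} [MeasurableSpace X]

/-- The volume of an equivariant map `Φ : Hyp K n × X → Hyp K m`, that is the integral over
`Γ \ Hyp K n` (computed on a fundamental domain, in coordinates) of the form `∫_X ω_x dμ(x)`. -/
def vol (Γ : Subgroup (G K n)) (μ : Measure X) (Φ : Hyp K n × X → Hyp K m) : ℝ≥0∞ :=
  ∫⁻ a in fundDomain Γ, ∫⁻ x, ENNReal.ofReal (pullbackVolume (fun b => Φ (b, x)) a) ∂μ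
    ∂(lebesgue K n)

open Classical in
/-- The natural volume of the cocycle `σ`, the volume of its natural map (and `0` by convention
if there is none). -/
def naturalVolume {Γ : Subgroup (G K n)} [MulAction Γ X] (μ : Measure X)
    (ν : Hyp K n → Measure (Bd K n)) (σ : Γ → X → G K m) : ℝ≥0∞ :=
  if h : AdmitsNaturalMap μ ν σ then vol Γ μ h.choose else 0

end Volume

end NaturalVolume

end

noncomputable section

namespace NaturalVolume

section Form

variable {K : Type*} [NormedDivisionRing K] [NormedAlgebra ℝ K] [StarRing K] [HypScalars K] {n : ℕ}

theorem norm_star_scalar (q : K) : ‖star q‖ = ‖q‖ := by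
  have : CStarRing K := HypScalars.cstar
  exact norm_star q

/-- The Hermitian form of signature `(n, 1)`. -/
def hermForm (v w : Fin n ⊕ Unit → K) : K := star v ⬝ᵥ (formMatrix K n *ᵥ w)

theorem hermForm_self (v : Fin n ⊕ Unit → K) : hermForm v v = algebraMap ℝ K (quadForm v) :=
  (algebraMap_quadForm v).symm

theorem hermForm_eq (v w : Fin n ⊕ Unit → K) :
    hermForm v w = ∑ i, star (v (Sum.inl i)) * w (Sum.inl i) -
      star (v (Sum.inr ())) * w (Sum.inr ()) := by
  simp [hermForm, formMatrix, dotProduct, Matrix.mulVec_diagonal, sub_eq_add_neg]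

theorem hermForm_mulVec (g : unitaryForm K n) (v w : Fin n ⊕ Unit → K) :
    hermForm (g.1.1 *ᵥ v) (g.1.1 *ᵥ w) = hermForm v w := by
  have hg : (g.1.1)ᴴ * formMatrix K n * g.1.1 = formMatrix K n := g.2
  rw [hermForm, hermForm, Matrix.star_mulVec, ← Matrix.dotProduct_mulVec,
    Matrix.mulVec_mulVec, Matrix.mulVec_mulVec, hg]

theorem star_hermForm (v w : Fin n ⊕ Unit → K) : star (hermForm v w) = hermForm w v := by
  simp [hermForm_eq]

theorem hermForm_add_right (u v w : Fin n ⊕ Unit → K) :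
    hermForm u (v + w) = hermForm u v + hermForm u w := by
  simp [hermForm, Matrix.mulVec_add]

theorem hermForm_mul_right (v w : Fin n ⊕ Unit → K) (l : K) :
    hermForm v (fun i => w i * l) = hermForm v w * l := by
  simp only [hermForm_eq, sub_mul, Finset.sum_mul, mul_assoc]

theorem hermForm_mul_left (v w : Fin n ⊕ Unit → K) (l : K) :
    hermForm (fun i => v i * l) w = star l * hermForm v w := by
  rw [← star_hermForm, hermForm_mul_right, star_mul, star_hermForm]

theorem hermForm_add_left (u v w : Fin n ⊕ Unit → K) :
    hermForm (u + v) w = hermForm u w + hermForm v w := by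
  rw [← star_hermForm, hermForm_add_right, star_add, star_hermForm, star_hermForm]

/-- The Gram determinant of `v` and `w`, up to sign. -/
def gram (v w : Fin n ⊕ Unit → K) : ℝ := ‖hermForm v w‖ ^ 2 - quadForm v * quadForm w

theorem algebraMap_gram (v w : Fin n ⊕ Unit → K) :
    algebraMap ℝ K (gram v w) =
      hermForm w v * hermForm v w - hermForm v v * hermForm w w := by
  rw [gram, map_sub, map_mul, ← hermForm_self, ← hermForm_self, ← star_mul_self_eq,
    star_hermForm]

theorem gram_add_mul (v w : Fin n ⊕ Unit → K) (l : K) :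
    gram v (w + fun i => v i * l) = gram v w := by
  apply (algebraMap ℝ K).injective
  rw [algebraMap_gram, algebraMap_gram]
  have hc : ∀ q : K, q * hermForm v v = hermForm v v * q := fun q => by
    rw [hermForm_self]
    exact (Algebra.commutes _ _).symm
  simp only [hermForm_add_left, hermForm_add_right, hermForm_mul_left, hermForm_mul_right]
  have h1 := hc (star l)
  generalize hermForm v v = q at *
  simp only [mul_add, add_mul, ← mul_assoc, h1, hc]
  abel

theorem gram_mul_mul (v w : Fin n ⊕ Unit → K) (l : K) :
    gram (fun i => v i * l) (fun i => w i * l) = gram v w * (‖l‖ ^ 2) ^ 2 := by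
  simp only [gram, quadForm_mul_right, hermForm_mul_left, hermForm_mul_right, norm_mul,
    norm_star_scalar]
  ring

theorem gram_mulVec (g : unitaryForm K n) (v w : Fin n ⊕ Unit → K) :
    gram (g.1.1 *ᵥ v) (g.1.1 *ᵥ w) = gram v w := by
  simp only [gram, quadForm_mulVec, hermForm_mulVec]

/-- The vector `(u, 0)` of `K^{n+1}`. -/
def tangentVec (u : Euc K n) : Fin n ⊕ Unit → K := Sum.elim (fun i => u i) (fun _ => 0)

theorem metricQ_eq_gram (a : Hyp K n) (u : Euc K n) :
    metricQ a u = gram (homog a.1) (tangentVec u) / quadForm (homog a.1) ^ 2 := by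
  have h1 : quadForm (tangentVec u) = ‖u‖ ^ 2 := by
    simp [quadForm, tangentVec, PiLp.norm_sq_eq_of_L2]
  have h2 : hermForm (homog a.1) (tangentVec u) = herm a.1 u := by
    simp [hermForm_eq, homog, tangentVec, herm]
  rw [metricQ, gram, h1, h2, quadForm_homog]
  congr 1 <;> ring

theorem hermForm_homog (z w : Euc K n) : hermForm (homog z) (homog w) = herm z w - 1 := by
  simp [hermForm_eq, homog, herm]

theorem norm_one_sub_herm_fracLin (g : unitaryForm K n) {z w : Euc K n} (hz : ‖z‖ ≤ 1)
    (hw : ‖w‖ ≤ 1) :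
    ‖1 - herm (fracLin g z) (fracLin g w)‖ =
      ‖1 - herm z w‖ * ‖((g.1.1 *ᵥ homog z) (Sum.inr ()))⁻¹‖ *
        ‖((g.1.1 *ᵥ homog w) (Sum.inr ()))⁻¹‖ := by
  have h := hermForm_homog (fracLin g z) (fracLin g w)
  rw [homog_fracLin g hz, homog_fracLin g hw, hermForm_mul_left, hermForm_mul_right,
    hermForm_mulVec, hermForm_homog] at h
  rw [norm_sub_rev, ← h, norm_mul, norm_mul, norm_star_scalar, norm_sub_rev 1]
  ring

theorem norm_herm_le (z w : Euc K n) : ‖herm z w‖ ≤ ‖z‖ * ‖w‖ := by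
  have h1 : ‖herm z w‖ ≤ ∑ i, ‖z i‖ * ‖w i‖ := by
    refine (norm_sum_le _ _).trans (Finset.sum_le_sum fun i _ => ?_)
    rw [norm_mul, norm_star_scalar]
  refine h1.trans ((Real.sum_mul_le_sqrt_mul_sqrt _ _ _).trans_eq ?_)
  rw [PiLp.norm_eq_of_L2, PiLp.norm_eq_of_L2]

theorem one_sub_herm_ne_zero {z w : Euc K n} (hz : ‖z‖ < 1) (hw : ‖w‖ ≤ 1) :
    0 < ‖1 - herm z w‖ := by
  rw [norm_pos_iff]
  intro h
  have h1 : herm z w = 1 := (sub_eq_zero.1 h).symm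
  have h2 := norm_herm_le z w
  rw [h1, norm_one] at h2
  nlinarith [norm_nonneg z, norm_nonneg w]

theorem continuous_herm_right (z : Euc K n) : Continuous fun w : Euc K n => herm z w := by
  unfold herm
  fun_prop

end Form

section Derivative

variable {K : Type*} [NormedDivisionRing K] [NormedAlgebra ℝ K] [StarRing K] [HypScalars K] {n : ℕ}

/-- The linear form `u ↦ (A (u, 0))ᵢ`. -/
def tangentRow (A : HMat K n) (i : Fin n ⊕ Unit) : Euc K n →L[ℝ] K :=
  ∑ j, (ContinuousLinearMap.mul ℝ K (A i (Sum.inl j))).comp (PiLp.proj 2 (fun _ => K) j)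

theorem tangentRow_apply (A : HMat K n) (i : Fin n ⊕ Unit) (u : Euc K n) :
    tangentRow A i u = (A *ᵥ tangentVec u) i := by
  simp [tangentRow, Matrix.mulVec, dotProduct, tangentVec]

theorem hasFDerivAt_mulVec_homog (A : HMat K n) (i : Fin n ⊕ Unit) (z : Euc K n) :
    HasFDerivAt (fun z => (A *ᵥ homog z) i) (tangentRow A i) z := by
  have h : (fun z => (A *ᵥ homog z) i) = fun z => tangentRow A i z + A i (Sum.inr ()) := by
    ext z
    simp [tangentRow, Matrix.mulVec, dotProduct, homog]
  rw [h]
  exact (tangentRow A i).hasFDerivAt.add_const _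

theorem exists_hasFDerivAt_fracLin (g : unitaryForm K n) {z : Euc K n} (hz : ‖z‖ ≤ 1) :
    ∃ D : Euc K n →L[ℝ] Euc K n, HasFDerivAt (fracLin g) D z ∧ ∀ u, tangentVec (D u) = fun i =>
      ((g.1.1 *ᵥ tangentVec u) i - (g.1.1 *ᵥ homog z) i *
        (((g.1.1 *ᵥ homog z) (Sum.inr ()))⁻¹ * (g.1.1 *ᵥ tangentVec u) (Sum.inr ()))) *
        ((g.1.1 *ᵥ homog z) (Sum.inr ()))⁻¹ := by
  have hd := denom_ne_zero g hz
  have hinv := (hasFDerivAt_inv' (𝕜 := ℝ) hd).comp z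
    (hasFDerivAt_mulVec_homog g.1.1 (Sum.inr ()) z)
  have hcoord : ∀ i : Fin n, HasFDerivAt (fun z => fracLin g z i) _ z := fun i =>
    (hasFDerivAt_mulVec_homog g.1.1 (Sum.inl i) z).mul' hinv
  have hpi := (PiLp.continuousLinearEquiv 2 ℝ (fun _ : Fin n => K)).symm.hasFDerivAt.comp z
    (hasFDerivAt_pi.2 hcoord)
  refine ⟨_, hpi, fun u => ?_⟩
  ext i
  rcases i with i | ⟨⟩
  · simp [tangentVec, tangentRow_apply]
    simp only [sub_mul, mul_assoc]
    abel
  · simp [tangentVec, hd]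

theorem metricQ_fracLin (g : unitaryForm K n) (a : Hyp K n) :
    ∃ D : Euc K n →L[ℝ] Euc K n, HasFDerivAt (fracLin g) D a.1 ∧
      ∀ u, metricQ (g • a) (D u) = metricQ a u := by
  obtain ⟨D, hD, hDu⟩ := exists_hasFDerivAt_fracLin g a.2.le
  refine ⟨D, hD, fun u => ?_⟩
  have hd := denom_ne_zero g a.2.le
  have hl : ‖((g.1.1 *ᵥ homog a.1) (Sum.inr ()))⁻¹‖ ≠ 0 := norm_ne_zero_iff.2 (inv_ne_zero hd)
  have hsplit : tangentVec (D u) = fun i => ((g.1.1 *ᵥ tangentVec u) + fun i =>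
      (g.1.1 *ᵥ homog a.1) i * -(((g.1.1 *ᵥ homog a.1) (Sum.inr ()))⁻¹ *
        (g.1.1 *ᵥ tangentVec u) (Sum.inr ()))) i * ((g.1.1 *ᵥ homog a.1) (Sum.inr ()))⁻¹ := by
    rw [hDu]
    ext i
    simp [sub_eq_add_neg]
  have hga : homog (g • a).1 = fun i =>
      (g.1.1 *ᵥ homog a.1) i * ((g.1.1 *ᵥ homog a.1) (Sum.inr ()))⁻¹ := homog_fracLin g a.2.le
  rw [metricQ_eq_gram, metricQ_eq_gram, hga, hsplit, gram_mul_mul, gram_add_mul, gram_mulVec,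
    quadForm_mul_right, quadForm_mulVec, mul_pow]
  exact mul_div_mul_right _ _ (by positivity)

theorem continuous_fracLin_uncurry (s : Set (Euc K n)) (hs : ∀ z ∈ s, ‖z‖ ≤ 1) :
    Continuous fun p : unitaryForm K n × s => fracLin p.1 p.2.1 := by
  have hrow : ∀ i, Continuous fun p : unitaryForm K n × s => (p.1.1.1 *ᵥ homog p.2.1) i := by
    intro i
    have h1 : Continuous fun p : unitaryForm K n × s => p.1.1.1 :=
      Units.continuous_val.comp (continuous_subtype_val.comp continuous_fst)
    have h2 : Continuous fun p : unitaryForm K n × s => homog p.2.1 := by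
      refine continuous_pi fun j => ?_
      rcases j with j | ⟨⟩
      · simp only [homog, Sum.elim_inl]
        fun_prop
      · simp only [homog, Sum.elim_inr]
        fun_prop
    exact (continuous_apply i).comp (h1.matrix_mulVec h2)
  refine (PiLp.continuous_toLp 2 _).comp (continuous_pi fun i => ?_)
  exact (hrow _).mul ((hrow _).inv₀ fun p => denom_ne_zero p.1 (hs _ p.2.2))

end Derivative

section Measurability

variable (K : Type*) [NormedDivisionRing K] [NormedAlgebra ℝ K] [StarRing K] [HypScalars K] (n : ℕ)

instance secondCountableTopology_scalars : SecondCountableTopology K :=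
  have : ProperSpace K := FiniteDimensional.proper ℝ K
  inferInstance

instance secondCountableTopology_units : SecondCountableTopology (HMat K n)ˣ :=
  have : SecondCountableTopology (HMat K n) :=
    inferInstanceAs (SecondCountableTopology (Fin n ⊕ Unit → Fin n ⊕ Unit → K))
  have : SecondCountableTopology (HMat K n)ᵐᵒᵖ :=
    MulOpposite.opHomeomorph.symm.secondCountableTopology
  Units.isEmbedding_embedProduct.secondCountableTopology

instance secondCountableTopology_G : SecondCountableTopology (G K n) :=
  have : SecondCountableTopology (unitaryForm K n) :=
    TopologicalSpace.Subtype.secondCountableTopology _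
  inferInstance

instance continuousSMul_hyp : ContinuousSMul (G K n) (Hyp K n) where
  continuous_smul := by
    have hq : IsOpenQuotientMap (Prod.map (QuotientGroup.mk : unitaryForm K n → G K n)
        (id : Hyp K n → Hyp K n)) := QuotientGroup.isOpenQuotientMap_mk.prodMap .id
    rw [← hq.continuous_comp_iff]
    exact (continuous_fracLin_uncurry {z : Euc K n | ‖z‖ < 1} fun z hz => le_of_lt hz).subtype_mk _

instance continuousSMul_bd : ContinuousSMul (G K n) (Bd K n) where
  continuous_smul := by
    have hq : IsOpenQuotientMap (Prod.map (QuotientGroup.mk : unitaryForm K n → G K n)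
        (id : Bd K n → Bd K n)) := QuotientGroup.isOpenQuotientMap_mk.prodMap .id
    rw [← hq.continuous_comp_iff]
    exact (continuous_fracLin_uncurry {z : Euc K n | ‖z‖ = 1} fun z hz => le_of_eq hz).subtype_mk _

end Measurability

section Pullback

variable {K : Type*} [NormedDivisionRing K] [NormedAlgebra ℝ K] [StarRing K] [HypScalars K]
  {n m : ℕ}

theorem extend_val_apply (Ψ : Hyp K n → Hyp K m) (a : Hyp K n) :
    Function.extend (fun z : Hyp K n => z.1) (fun z => (Ψ z).1) 0 a.1 = (Ψ a).1 :=
  Subtype.val_injective.extend_apply (fun z => (Ψ z).1) 0 a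

theorem extend_smul_eventuallyEq (g : unitaryForm K m) (Ψ : Hyp K n → Hyp K m) (a : Hyp K n) :
    Function.extend (fun z : Hyp K n => z.1) (fun z => (g • Ψ z).1) 0 =ᶠ[𝓝 a.1]
      fracLin g ∘ Function.extend (fun z : Hyp K n => z.1) (fun z => (Ψ z).1) 0 := by
  have h : {z : Euc K n | ‖z‖ < 1} ∈ 𝓝 a.1 :=
    (isOpen_lt continuous_norm continuous_const).mem_nhds a.2
  filter_upwards [h] with z hz
  have h1 := extend_val_apply (fun z => g • Ψ z) ⟨z, hz⟩
  have h2 := extend_val_apply Ψ ⟨z, hz⟩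
  exact h1.trans (congrArg (fracLin g) h2).symm

theorem hderiv_smul (g : unitaryForm K m) {Ψ : Hyp K n → Hyp K m} {a : Hyp K n}
    (h : DifferentiableAt ℝ (Function.extend (fun z : Hyp K n => z.1) (fun z => (Ψ z).1) 0) a.1)
    {D : Euc K m →L[ℝ] Euc K m} (hD : HasFDerivAt (fracLin g) D (Ψ a).1) :
    HasFDerivAt (Function.extend (fun z : Hyp K n => z.1) (fun z => (g • Ψ z).1) 0)
      (D.comp (hderiv Ψ a)) a.1 := by
  rw [← extend_val_apply Ψ a] at hD
  exact (hD.comp a.1 h.hasFDerivAt).congr_of_eventuallyEq (extend_smul_eventuallyEq g Ψ a)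

theorem metric_hderiv_smul (g : unitaryForm K m) (Ψ : Hyp K n → Hyp K m) (a : Hyp K n)
    (u v : Euc K n) :
    metric (g • Ψ a) (hderiv (fun z => g • Ψ z) a u) (hderiv (fun z => g • Ψ z) a v) =
      metric (Ψ a) (hderiv Ψ a u) (hderiv Ψ a v) := by
  by_cases h : DifferentiableAt ℝ
      (Function.extend (fun z : Hyp K n => z.1) (fun z => (Ψ z).1) 0) a.1
  · obtain ⟨D, hD, hQ⟩ := metricQ_fracLin g (Ψ a)
    have h1 : hderiv (fun z => g • Ψ z) a = D.comp (hderiv Ψ a) := (hderiv_smul g h hD).fderiv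
    rw [h1]
    simp only [metric, ContinuousLinearMap.comp_apply, ← map_add, ← map_sub, hQ]
  · have h' : ¬ DifferentiableAt ℝ
        (Function.extend (fun z : Hyp K n => z.1) (fun z => (g • Ψ z).1) 0) a.1 := by
      intro hg
      obtain ⟨D, hD, -⟩ := metricQ_fracLin g⁻¹ (g • Ψ a)
      have h2 := hderiv_smul g⁻¹ hg hD
      simp only [inv_smul_smul] at h2
      exact h h2.differentiableAt
    have h1 : hderiv Ψ a = 0 := fderiv_zero_of_not_differentiableAt h
    have h2 : hderiv (fun z => g • Ψ z) a = 0 := fderiv_zero_of_not_differentiableAt h'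
    simp [h1, h2, metric]

theorem pullbackVolume_smul (g : G K m) (Ψ : Hyp K n → Hyp K m) (a : Hyp K n) :
    pullbackVolume (fun z => g • Ψ z) a = pullbackVolume Ψ a := by
  obtain ⟨g, rfl⟩ := QuotientGroup.mk_surjective g
  have h := metric_hderiv_smul g Ψ a
  unfold pullbackVolume
  congr 2
  ext i j
  exact h _ _

end Pullback

section Busemann

variable {K : Type*} [NormedDivisionRing K] [NormedAlgebra ℝ K] [StarRing K] [HypScalars K] {n : ℕ}

theorem star_algebraMap (r : ℝ) : star (algebraMap ℝ K r) = algebraMap ℝ K r := by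
  rcases eq_or_ne r 0 with rfl | hr
  · simp
  · have h := star_mul_self_eq (algebraMap ℝ K r)
    rw [norm_algebraMap', Real.norm_eq_abs, sq_abs, pow_two, map_mul] at h
    exact mul_right_cancel₀ ((map_ne_zero _).2 hr) h

theorem herm_smul_smul (s t : ℝ) (z : Euc K n) :
    herm (s • z) (t • z) = algebraMap ℝ K (s * t * ‖z‖ ^ 2) := by
  have hs : ∀ q : K, star (s • q) = s • star q := fun q => by
    rw [Algebra.smul_def, star_mul, star_algebraMap, Algebra.smul_def, Algebra.commutes]
  simp only [herm, PiLp.smul_apply, hs, smul_mul_smul_comm, star_mul_self_eq]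
  rw [← Finset.smul_sum, ← map_sum, PiLp.norm_sq_eq_of_L2, Algebra.smul_def, ← map_mul]

theorem sqrt_one_sub_norm_sq_pos (a : Hyp K n) : 0 < √(1 - ‖a.1‖ ^ 2) :=
  Real.sqrt_pos.2 (by nlinarith [norm_nonneg a.1, a.2])

theorem norm_smul_bd (r : ℝ) (ξ : Bd K n) : ‖r • ξ.1‖ = |r| := by
  rw [norm_smul, ξ.2, mul_one, Real.norm_eq_abs]

theorem one_sub_tanh_sq (t : ℝ) : 1 - Real.tanh t ^ 2 = (Real.cosh t)⁻¹ ^ 2 := by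
  have h := Real.cosh_sq t
  have hc := (Real.cosh_pos t).ne'
  rw [Real.tanh_eq_sinh_div_cosh]
  field_simp
  linarith

/-- The radial ray from the centre of the ball. -/
def radialRay (ξ : Bd K n) (t : ℝ) : Hyp K n :=
  ⟨Real.tanh t • ξ.1, by rw [norm_smul_bd]; exact Real.abs_tanh_lt_one t⟩

theorem tendsto_tanh_atTop_one : Tendsto Real.tanh atTop (𝓝 1) := by
  have h : Real.tanh = fun t => 1 - 2 / (Real.exp (2 * t) + 1) := by
    ext t
    have h1 : Real.exp (2 * t) = Real.exp t * Real.exp t := by rw [← Real.exp_add]; ring_nf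
    rw [Real.tanh_eq_sinh_div_cosh, Real.sinh_eq, Real.cosh_eq, h1, Real.exp_neg]
    have := Real.exp_pos t
    field_simp
    ring
  rw [h]
  have h2 : Tendsto (fun t : ℝ => Real.exp (2 * t) + 1) atTop atTop :=
    tendsto_atTop_add_const_right _ _
      (Real.tendsto_exp_atTop.comp (tendsto_id.const_mul_atTop two_pos))
  simpa using (tendsto_const_nhds (x := (1 : ℝ))).sub (h2.const_div_atTop 2)

theorem isGeodesicRay_radialRay (ξ : Bd K n) :
    IsGeodesicRay (radialRay ξ) (basept K n) ξ where
  start := Subtype.ext (by simp [radialRay, basept])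
  isometric s t _ _ := by
    have hs := Real.cosh_pos s
    have ht := Real.cosh_pos t
    have hsq : ∀ t, √(1 - ‖(radialRay ξ t).1‖ ^ 2) = (Real.cosh t)⁻¹ := fun t => by
      have : ‖(radialRay ξ t).1‖ = |Real.tanh t| := norm_smul_bd _ _
      rw [this, sq_abs, one_sub_tanh_sq, Real.sqrt_sq (inv_nonneg.2 (Real.cosh_pos t).le)]
    have hnum : ‖1 - herm (radialRay ξ s).1 (radialRay ξ t).1‖ = Real.cosh (s - t) *
        ((Real.cosh s)⁻¹ * (Real.cosh t)⁻¹) := by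
      have h1 : herm (radialRay ξ s).1 (radialRay ξ t).1 = _ := herm_smul_smul _ _ ξ.1
      rw [h1, ξ.2, ← map_one (algebraMap ℝ K), ← map_sub, norm_algebraMap']
      have h2 : 1 - Real.tanh s * Real.tanh t * 1 ^ 2 = Real.cosh (s - t) *
          ((Real.cosh s)⁻¹ * (Real.cosh t)⁻¹) := by
        rw [Real.cosh_sub, Real.tanh_eq_sinh_div_cosh, Real.tanh_eq_sinh_div_cosh]
        field_simp
      rw [h2, Real.norm_of_nonneg]
      have := Real.cosh_pos (s - t)
      positivity
    rw [hdist, hnum, hsq, hsq, mul_div_cancel_right₀ _ (by positivity), ← Real.cosh_abs,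
      Real.arcosh_cosh (abs_nonneg _)]
  tendsto := by
    simpa [radialRay] using tendsto_tanh_atTop_one.smul_const ξ.1

theorem arcosh_div {A s : ℝ} (hA : 0 < A) (hs : 0 < s) :
    Real.arcosh (A / s) = Real.log (A + √(A ^ 2 - s ^ 2)) - Real.log s := by
  have h : √((A / s) ^ 2 - 1) = √(A ^ 2 - s ^ 2) / s := by
    rw [← Real.sqrt_sq hs.le, ← Real.sqrt_div' _ (sq_nonneg s), Real.sqrt_sq hs.le]
    congr 1
    field_simp
  rw [Real.arcosh, h, ← add_div, Real.log_div _ hs.ne']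
  have := Real.sqrt_nonneg (A ^ 2 - s ^ 2)
  positivity

/-- The horospherical function of `ξ`, up to an additive constant. -/
def horo (a : Hyp K n) (ξ : Euc K n) : ℝ := ‖1 - herm a.1 ξ‖ / √(1 - ‖a.1‖ ^ 2)

theorem horo_pos (a : Hyp K n) {ξ : Euc K n} (hξ : ‖ξ‖ ≤ 1) : 0 < horo a ξ :=
  div_pos (one_sub_herm_ne_zero a.2 hξ) (sqrt_one_sub_norm_sq_pos a)

theorem continuous_horo (a : Hyp K n) : Continuous (horo a) :=
  ((continuous_const.sub (continuous_herm_right a.1)).norm).div_const _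

theorem IsGeodesicRay.tendsto_hdist_sub {c : ℝ → Hyp K n} {b : Hyp K n} {ξ : Bd K n}
    (hc : IsGeodesicRay c b ξ) (a : Hyp K n) :
    Tendsto (fun t => hdist a (c t) - hdist b (c t)) atTop
      (𝓝 (Real.log (horo a ξ.1) - Real.log (horo b ξ.1))) := by
  set s : ℝ → ℝ := fun t => √(1 - ‖(c t).1‖ ^ 2) with hs
  have hspos : ∀ t, 0 < s t := fun t => sqrt_one_sub_norm_sq_pos (c t)
  have hs0 : Tendsto s atTop (𝓝 0) := by
    have := ((hc.tendsto.norm.pow 2).const_sub 1).sqrt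
    simpa [ξ.2] using this
  have hd : ∀ a t, hdist a (c t) =
      Real.log (horo a (c t).1 + √(horo a (c t).1 ^ 2 - s t ^ 2)) - Real.log (s t) := by
    intro a t
    rw [← arcosh_div (horo_pos a (c t).2.le) (hspos t), hdist, horo, div_div]
  have hlim : ∀ a : Hyp K n, Tendsto
      (fun t => Real.log (horo a (c t).1 + √(horo a (c t).1 ^ 2 - s t ^ 2))) atTop
      (𝓝 (Real.log (2 * horo a ξ.1))) := by
    intro a
    have h1 := ((continuous_horo a).tendsto ξ.1).comp hc.tendsto
    have h2 := h1.add ((h1.pow 2).sub (hs0.pow 2)).sqrt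
    have hp := horo_pos a ξ.2.le
    have h3 : horo a ξ.1 + √(horo a ξ.1 ^ 2 - 0 ^ 2) = 2 * horo a ξ.1 := by
      rw [zero_pow two_ne_zero, sub_zero, Real.sqrt_sq hp.le, two_mul]
    rw [h3] at h2
    exact h2.log (by positivity)
  have h := (hlim a).sub (hlim b)
  rw [Real.log_mul two_ne_zero (horo_pos a ξ.2.le).ne',
    Real.log_mul two_ne_zero (horo_pos b ξ.2.le).ne', add_sub_add_left_eq_sub] at h
  refine h.congr fun t => ?_
  rw [hd a t, hd b t]
  ring

theorem busemann_basept (a : Hyp K n) (ξ : Bd K n) :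
    busemann (basept K n) a ξ = Real.log (horo a ξ.1) := by
  have hray : IsGeodesicRay (ray (basept K n) ξ) (basept K n) ξ :=
    Classical.epsilon_spec (p := fun c => IsGeodesicRay c (basept K n) ξ)
      ⟨_, isGeodesicRay_radialRay ξ⟩
  have h0 : horo (basept K n) ξ.1 = 1 := by simp [horo, basept, herm]
  rw [busemann, (hray.tendsto_hdist_sub a).limUnder_eq, h0, Real.log_one, sub_zero]

theorem busemann_smul (g : G K n) (a : Hyp K n) (ξ : Bd K n) :
    busemann (basept K n) (g • a) (g • ξ) =
      busemann (basept K n) a ξ + busemann (basept K n) (g • basept K n) (g • ξ) := by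
  obtain ⟨g, rfl⟩ := QuotientGroup.mk_surjective g
  have hj : ‖((g.1.1 *ᵥ homog ξ.1) (Sum.inr ()))⁻¹‖ ≠ 0 :=
    norm_ne_zero_iff.2 (inv_ne_zero (denom_ne_zero g ξ.2.le))
  have key : ∀ a : Hyp K n, horo ((g : G K n) • a) ((g : G K n) • ξ).1 =
      horo a ξ.1 * ‖((g.1.1 *ᵥ homog ξ.1) (Sum.inr ()))⁻¹‖ := by
    intro a
    have ha : ‖((g.1.1 *ᵥ homog a.1) (Sum.inr ()))⁻¹‖ ≠ 0 :=
      norm_ne_zero_iff.2 (inv_ne_zero (denom_ne_zero g a.2.le))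
    have hp := (sqrt_one_sub_norm_sq_pos a).ne'
    rw [horo, horo, mk_smul_hyp, mk_smul_bd, norm_one_sub_herm_fracLin g a.2.le ξ.2.le,
      norm_fracLin g a.2.le, Real.sqrt_mul' _ (sq_nonneg _), Real.sqrt_sq (norm_nonneg _)]
    field_simp
  have h0 : horo (basept K n) ξ.1 = 1 := by simp [horo, basept, herm]
  simp only [busemann_basept, key, h0, one_mul]
  exact Real.log_mul (horo_pos a ξ.2.le).ne' hj

theorem continuous_busemann_basept (a : Hyp K n) :
    Continuous fun ξ : Bd K n => busemann (basept K n) a ξ := by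
  simp only [busemann_basept]
  exact ((continuous_horo a).comp continuous_subtype_val).log fun ξ => (horo_pos a ξ.2.le).ne'

instance compactSpace_bd : CompactSpace (Bd K n) := by
  have : ProperSpace (Euc K n) := FiniteDimensional.proper ℝ _
  have h : IsCompact {z : Euc K n | ‖z‖ = 1} := by
    simpa [Metric.sphere] using isCompact_sphere (0 : Euc K n) 1
  exact isCompact_iff_compactSpace.1 h

theorem integrable_busemann_basept (ν : Measure (Bd K n)) [IsFiniteMeasure ν] (a : Hyp K n) :
    Integrable (fun ξ => busemann (basept K n) a ξ) ν :=
  (continuous_busemann_basept a).integrable_of_hasCompactSupport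
    (HasCompactSupport.of_compactSpace _)

theorem avgBusemann_map_smul (ν : Measure (Bd K n)) [IsFiniteMeasure ν] (g : G K n)
    (y : Hyp K n) :
    avgBusemann (ν.map fun ξ => g • ξ) (g • y) =
      avgBusemann ν y + avgBusemann (ν.map fun ξ => g • ξ) (g • basept K n) := by
  have hg : Continuous fun ξ : Bd K n => g • ξ := continuous_const_smul g
  have hint : Integrable (fun ξ => busemann (basept K n) (g • basept K n) (g • ξ)) ν :=
    (integrable_busemann_basept (ν.map fun ξ => g • ξ) _).comp_aemeasurable hg.aemeasurable
  unfold avgBusemann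
  rw [integral_map hg.aemeasurable (continuous_busemann_basept _).aestronglyMeasurable,
    integral_map hg.aemeasurable (continuous_busemann_basept _).aestronglyMeasurable,
    ← integral_add (integrable_busemann_basept ν y) hint]
  simp only [busemann_smul g y]

theorem IsBarycenter.map_smul {ν : Measure (Bd K n)} [IsFiniteMeasure ν] {y : Hyp K n}
    (h : IsBarycenter ν y) (g : G K n) : IsBarycenter (ν.map fun ξ => g • ξ) (g • y) := by
  intro z hz
  have h1 := h (g⁻¹ • z) fun h2 => hz (by rw [← h2, smul_inv_smul])
  have h3 := avgBusemann_map_smul ν g (g⁻¹ • z)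
  rw [smul_inv_smul] at h3
  rw [h3, avgBusemann_map_smul ν g y]
  linarith

theorem IsBarycenter.unique {ν : Measure (Bd K n)} {y z : Hyp K n} (hy : IsBarycenter ν y)
    (hz : IsBarycenter ν z) : y = z := by
  by_contra h
  exact lt_asymm (hy z (Ne.symm h)) (hz y h)

end Busemann

section Cocycles

variable {K : Type*} [NormedDivisionRing K] [NormedAlgebra ℝ K] [StarRing K] [HypScalars K]
  {n m : ℕ} {Γ : Subgroup (G K n)} {X : Type*} [MeasurableSpace X] [MulAction Γ X]
  {μ : Measure X}

theorem IsCocycle.twist {σ : Γ → X → G K m} (hσ : IsCocycle μ σ)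
    (hX : ∀ γ : Γ, Measurable fun x : X => γ • x) {f : X → G K m} (hf : Measurable f) :
    IsCocycle μ (twist σ f) where
  measurable γ := ((hf.comp (hX γ)).inv.mul (hσ.measurable γ)).mul hf
  cocycle γ₁ γ₂ := by
    filter_upwards [hσ.cocycle γ₁ γ₂] with x hx
    simp only [NaturalVolume.twist, hx, mul_smul]
    group

theorem twist_twist_inv (σ : Γ → X → G K m) (f : X → G K m) :
    twist (twist σ f) f⁻¹ = σ := by
  ext γ x
  simp only [twist, Pi.inv_apply]
  group

theorem IsBoundaryMap.twist {ν₀ : Measure (Bd K n)} {σ : Γ → X → G K m}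
    {φ : Bd K n × X → Bd K m} (h : IsBoundaryMap μ ν₀ σ φ) {f : X → G K m} (hf : Measurable f) :
    IsBoundaryMap μ ν₀ (twist σ f) fun p => (f p.2)⁻¹ • φ p where
  measurable := (hf.comp measurable_snd).inv.smul h.measurable
  equivariant γ := by
    filter_upwards [h.equivariant γ] with p hp
    simp only [NaturalVolume.twist, hp, ← mul_smul]
    group

theorem IsBoundaryMap.congr_ae {ν₀ : Measure (Bd K n)} [SFinite μ] {σ σ' : Γ → X → G K m}
    {φ : Bd K n × X → Bd K m} (h : IsBoundaryMap μ ν₀ σ φ)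
    (hσ : ∀ γ, ∀ᵐ x ∂μ, σ' γ x = σ γ x) : IsBoundaryMap μ ν₀ σ' φ where
  measurable := h.measurable
  equivariant γ := by
    filter_upwards [h.equivariant γ, Measure.quasiMeasurePreserving_snd.ae (hσ γ)] with p hp hp'
    rw [hp, hp']

theorem IsNaturalMap.congr_ae [SFinite μ] {ν : Hyp K n → Measure (Bd K n)}
    {σ σ' : Γ → X → G K m} {F : Hyp K n × X → Hyp K m} (h : IsNaturalMap μ ν σ F)
    (hσ : ∀ γ, ∀ᵐ x ∂μ, σ' γ x = σ γ x) : IsNaturalMap μ ν σ' F := by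
  obtain ⟨φ, hφ, hbar⟩ := h.barycenter
  exact ⟨h.measurable, φ,
    { hφ.toIsBoundaryMap.congr_ae hσ with
      essUnique := fun ψ hψ => hφ.essUnique ψ (hψ.congr_ae fun γ => (hσ γ).mono fun _ => Eq.symm)
      essInjective := hφ.essInjective }, hbar⟩

theorem IsEssUniqueInjectiveBoundaryMap.twist {ν₀ : Measure (Bd K n)} {σ : Γ → X → G K m}
    {φ : Bd K n × X → Bd K m} (h : IsEssUniqueInjectiveBoundaryMap μ ν₀ σ φ)
    {f : X → G K m} (hf : Measurable f) :
    IsEssUniqueInjectiveBoundaryMap μ ν₀ (twist σ f) fun p => (f p.2)⁻¹ • φ p where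
  toIsBoundaryMap := h.toIsBoundaryMap.twist hf
  essUnique ψ hψ := by
    have h1 := hψ.twist hf.inv
    rw [twist_twist_inv] at h1
    filter_upwards [h.essUnique _ h1] with p hp
    simp only [Pi.inv_apply, inv_inv] at hp
    rw [← hp, inv_smul_smul]
  essInjective := by
    filter_upwards [h.essInjective] with x ⟨s, hs, hinj⟩
    exact ⟨s, hs, fun ξ hξ η hη hξη => hinj hξ hη (MulAction.injective _ hξη)⟩

theorem IsNaturalMap.twist {ν : Hyp K n → Measure (Bd K n)} [∀ a, IsFiniteMeasure (ν a)]
    {σ : Γ → X → G K m} {F : Hyp K n × X → Hyp K m} (h : IsNaturalMap μ ν σ F)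
    {f : X → G K m} (hf : Measurable f) :
    IsNaturalMap μ ν (twist σ f) fun p => (f p.2)⁻¹ • F p := by
  obtain ⟨φ, hφ, hbar⟩ := h.barycenter
  refine ⟨(hf.comp measurable_snd).inv.smul h.measurable, _, hφ.twist hf, ?_⟩
  filter_upwards [hbar] with x hx a
  have hm : Measurable fun ξ => φ (ξ, x) := hφ.measurable.comp measurable_prodMk_right
  have h1 := (hx a).map_smul (f x)⁻¹
  rwa [Measure.map_map (continuous_const_smul _).measurable hm] at h1

theorem IsNaturalMap.ae_eq [SFinite μ] {ν : Hyp K n → Measure (Bd K n)}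
    [∀ a, SFinite (ν a)] (hν : ∀ a b, ν a ≪ ν b) {σ : Γ → X → G K m}
    {F F' : Hyp K n × X → Hyp K m} (h : IsNaturalMap μ ν σ F) (h' : IsNaturalMap μ ν σ F') :
    ∀ᵐ x ∂μ, ∀ a, F (a, x) = F' (a, x) := by
  obtain ⟨φ, hφ, hbar⟩ := h.barycenter
  obtain ⟨φ', hφ', hbar'⟩ := h'.barycenter
  have h1 : ∀ᵐ q ∂(μ.prod (ν (basept K n))), φ q.swap = φ' q.swap := by
    have h2 := hφ'.essUnique φ hφ.toIsBoundaryMap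
    rw [← Measure.prod_swap] at h2
    exact ae_of_ae_map measurable_swap.aemeasurable h2
  filter_upwards [Measure.ae_ae_of_ae_prod h1, hbar, hbar'] with x hx hb hb' a
  have h3 : (ν a).map (fun ξ => φ (ξ, x)) = (ν a).map fun ξ => φ' (ξ, x) :=
    Measure.map_congr ((hν a (basept K n)).ae_le hx)
  have h4 := hb a
  rw [h3] at h4
  exact h4.unique (hb' a)

theorem vol_congr_ae {F F' : Hyp K n × X → Hyp K m}
    (h : ∀ᵐ x ∂μ, ∀ a, F (a, x) = F' (a, x)) : vol Γ μ F = vol Γ μ F' := by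
  unfold vol
  congr 1
  ext a
  refine lintegral_congr_ae ?_
  filter_upwards [h] with x hx
  simp only [hx]

theorem vol_smul (F : Hyp K n × X → Hyp K m) (f : X → G K m) :
    vol Γ μ (fun p => f p.2 • F p) = vol Γ μ F := by
  unfold vol
  congr 1
  ext a
  refine lintegral_congr fun x => ?_
  exact congrArg _ (pullbackVolume_smul (f x) (fun b => F (b, x)) a)

theorem IsNaturalMap.naturalVolume_eq [SFinite μ] {ν : Hyp K n → Measure (Bd K n)}
    [∀ a, SFinite (ν a)] (hν : ∀ a b, ν a ≪ ν b) {σ : Γ → X → G K m}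
    {F : Hyp K n × X → Hyp K m} (h : IsNaturalMap μ ν σ F) :
    naturalVolume μ ν σ = vol Γ μ F := by
  have hex : AdmitsNaturalMap μ ν σ := ⟨F, h⟩
  rw [naturalVolume, dif_pos hex]
  exact vol_congr_ae (hex.choose_spec.ae_eq hν h)

end Cocycles

end NaturalVolume

end

theorem mainTheorem6 {K : Type*} [NormedDivisionRing K] [NormedAlgebra ℝ K] [StarRing K]
    [HypScalars K] (n m : ℕ) (hn : 2 ≤ Module.finrank ℝ K * (n - 1)) (hnm : n ≤ m)
    (Γ : Subgroup (NaturalVolume.G K n)) (hΓ : NaturalVolume.IsTorsionFreeUniformLattice Γ)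
    (ν : NaturalVolume.Hyp K n → MeasureTheory.Measure (NaturalVolume.Bd K n))
    (hν : NaturalVolume.IsPattersonSullivan Γ ν)
    {X : Type*} [MeasurableSpace X] [StandardBorelSpace X] (μ : MeasureTheory.Measure X)
    [MeasureTheory.IsProbabilityMeasure μ] [MeasureTheory.NullSingletonClass μ] [MulAction Γ X]
    (hX : ∀ γ : Γ, MeasureTheory.MeasurePreserving (fun x : X => γ • x) μ μ)
    (σ : Γ → X → NaturalVolume.G K m) (hσ : NaturalVolume.IsCocycle μ σ)
    (hF : NaturalVolume.AdmitsNaturalMap μ ν σ) :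
    (∀ f : X → NaturalVolume.G K m, Measurable f →
      NaturalVolume.IsCocycle μ (NaturalVolume.twist σ f) ∧
      NaturalVolume.AdmitsNaturalMap μ ν (NaturalVolume.twist σ f) ∧
      NaturalVolume.naturalVolume μ ν (NaturalVolume.twist σ f) =
        NaturalVolume.naturalVolume μ ν σ) ∧
    (∀ σ' : Γ → X → NaturalVolume.G K m, NaturalVolume.IsCocycle μ σ' →
      NaturalVolume.Cohomologous μ σ σ' →
      NaturalVolume.AdmitsNaturalMap μ ν σ' ∧
      NaturalVolume.naturalVolume μ ν σ' = NaturalVolume.naturalVolume μ ν σ) := by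
  have hprob := hν.2.isProb
  have hac := hν.2.absCont
  obtain ⟨F, hF⟩ := hF
  have hvol := hF.naturalVolume_eq hac
  refine ⟨fun f hf => ?_, ?_⟩
  · have hFf := hF.twist hf
    refine ⟨hσ.twist (fun γ => (hX γ).measurable) hf, ⟨_, hFf⟩, ?_⟩
    rw [hvol, hFf.naturalVolume_eq hac]
    exact NaturalVolume.vol_smul F fun x => (f x)⁻¹
  · rintro σ' - ⟨f, hf, hσ'⟩
    have hFf := (hF.twist hf).congr_ae hσ'
    refine ⟨⟨_, hFf⟩, ?_⟩
    rw [hvol, hFf.naturalVolume_eq hac]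
    exact NaturalVolume.vol_smul F fun x => (f x)⁻¹
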